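/- Let $(\alpha_k)_{k\ge1}$, $(\beta_k)_{k\ge1}$, $(\delta_k)_{k\ge1}$ be sequences of random variables on a probability space, all of them (over all three sequences and all indices) mutually independent, where every $\alpha_k$, $\beta_k$, $\delta_k$ is exponentially distributed with parameter (rate) $\mu>0$, $\nu>0$, $\tau>0$ respectively. Consider the system $z(k)=A(k)z(k-1)$, $k\ge1$, in the semiring with the operations of maximum and addition, where $$A(k)=\begin{pmatrix}\alpha_k&\beta_k\\0&\delta_k\end{pmatrix},\qquad z(k)=\begin{pmatrix}x(k)\\y(k)\end{pmatrix},\qquad z(0)=\begin{pmatrix}0\\0\end{pmatrix};$$ that is, $x(0)=y(0)=0$ and, for $k\ge 1$, $$x(k)=\max(x(k-1)+\alpha_k,\;y(k-1)+\beta_k),\qquad y(k)=\max(x(k-1),\;y(k-1)+\delta_k).$$ (The lower left entry is the real number $0$.) Then in each of the following two cases the Lyapunov exponent $$\lambda=\lim_{k\to\infty}\frac1k\max(x(k),y(k))$$ exists almost surely and is the indicated constant. 1. If $\nu=\mu$, then $\lambda=P_1(\mu,\tau)/Q_1(\mu,\tau)$, where $$\begin{aligned}P_1(\mu,\tau)={}&288\mu^{8}+1048\mu^{7}\tau+1936\mu^{6}\tau^{2}+2688\mu^{5}\tau^{3}+3012\mu^{4}\tau^{4}\\&+2226\mu^{3}\tau^{5}+941\mu^{2}\tau^{6}+204\mu\tau^{7}+17\tau^{8},\\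 Q_1(\mu,\tau)={}&2\mu\tau(144\mu^{7}+524\mu^{6}\tau+968\mu^{5}\tau^{2}+1200\mu^{4}\tau^{3}+910\mu^{3}\tau^{4}\\&+387\mu^{2}\tau^{5}+84\mu\tau^{6}+7\tau^{7}).\end{aligned}$$ 2. If $\tau=\mu$, then $\lambda=P_2(\mu,\nu)/Q_2(\mu,\nu)$, where $$\begin{aligned}P_2(\mu,\nu)={}&256\mu^{10}+2112\mu^{9}\nu+8044\mu^{8}\nu^{2}+19355\mu^{7}\nu^{3}+32167\mu^{6}\nu^{4}+36887\mu^{5}\nu^{5}\\&+28709\mu^{4}\nu^{6}+14854\mu^{3}\nu^{7}+4912\mu^{2}\nu^{8}+944\mu\nu^{9}+80\nu^{10},\\ Q_2(\mu,\nu)={}&2\mu\nu(\mu+\nu)(192\mu^{8}+1344\mu^{7}\nu+4047\mu^{6}\nu^{2}+6770\mu^{5}\nu^{3}+6799\mu^{4}\nu^{4}\\&+4216\mu^{3}\nu^{5}+1600\mu^{2}\nu^{6}+344\mu\nu^{7}+32\nu^{8}).\end{aligned}$$ -/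

import Mathlib

/-!
The difference `d = y - x` of the coordinates is a Markov chain, and the growth of `max x y` in one
step is a function of `d` and of the noise. If a bounded function `h` solves the Poisson equation
of this chain with constant `L`, then `max (x k) (y k) + h (d k) - k L` is a sum of orthogonal
variables with bounded second moments, hence `o(k)` almost surely, and `L` is the Lyapunov exponent.

By memorylessness, the excess of an exponential variable over the level `|d|` is either `0` or again
exponential with the same rate, so the law of one step from any `d` is a mixture of five laws that
do not depend on `d`. The Poisson equation thus becomes a linear system in five unknowns, which has
an explicit solution when `ν = μ` or `τ = μ`.
-/

open MeasureTheory ProbabilityTheory Filter Topology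

/-- The state vector `z(k) = (x(k), y(k))` of the second-order max-plus linear system
`z(k) = A(k) z(k-1)`, `z(0) = (0, 0)`, that is
`x(k) = max (x(k-1) + A(k)₁₁) (y(k-1) + A(k)₁₂)`,
`y(k) = max (x(k-1) + A(k)₂₁) (y(k-1) + A(k)₂₂)`.
The entry `A k` of the sequence (indexed from `0`) is the transition matrix of step `k + 1`. -/
def maxPlusState (A : ℕ → Matrix (Fin 2) (Fin 2) ℝ) : ℕ → Fin 2 → ℝ
  | 0 => fun _ => 0
  | k + 1 => fun i =>
      max (maxPlusState A k 0 + A k i 0) (maxPlusState A k 1 + A k i 1)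

/-- The number `L` is the Lyapunov exponent of the system with random transition matrices `A`:
almost surely, `max (x(k)) (y(k)) / k` converges to `L`. -/
def IsLyapunovExponent {Ω : Type*} [MeasurableSpace Ω] (Pr : Measure Ω)
    (A : ℕ → Ω → Matrix (Fin 2) (Fin 2) ℝ) (L : ℝ) : Prop :=
  ∀ᵐ ω ∂Pr, Tendsto
    (fun k : ℕ => (1 / (k : ℝ)) *
      max (maxPlusState (fun j => A j ω) k 0) (maxPlusState (fun j => A j ω) k 1))
    atTop (𝓝 L)

/-- Numerator in the case `ν = μ`. -/
def numEqNu (μ τ : ℝ) : ℝ :=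
  288 * μ ^ 8 + 1048 * μ ^ 7 * τ + 1936 * μ ^ 6 * τ ^ 2 + 2688 * μ ^ 5 * τ ^ 3
    + 3012 * μ ^ 4 * τ ^ 4 + 2226 * μ ^ 3 * τ ^ 5 + 941 * μ ^ 2 * τ ^ 6
    + 204 * μ * τ ^ 7 + 17 * τ ^ 8

/-- Denominator in the case `ν = μ`. -/
def denEqNu (μ τ : ℝ) : ℝ :=
  2 * μ * τ *
    (144 * μ ^ 7 + 524 * μ ^ 6 * τ + 968 * μ ^ 5 * τ ^ 2 + 1200 * μ ^ 4 * τ ^ 3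
      + 910 * μ ^ 3 * τ ^ 4 + 387 * μ ^ 2 * τ ^ 5 + 84 * μ * τ ^ 6 + 7 * τ ^ 7)

/-- Numerator in the case `τ = μ`. -/
def numEqTau (μ ν : ℝ) : ℝ :=
  256 * μ ^ 10 + 2112 * μ ^ 9 * ν + 8044 * μ ^ 8 * ν ^ 2 + 19355 * μ ^ 7 * ν ^ 3
    + 32167 * μ ^ 6 * ν ^ 4 + 36887 * μ ^ 5 * ν ^ 5 + 28709 * μ ^ 4 * ν ^ 6
    + 14854 * μ ^ 3 * ν ^ 7 + 4912 * μ ^ 2 * ν ^ 8 + 944 * μ * ν ^ 9 + 80 * ν ^ 10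

/-- Denominator in the case `τ = μ`. -/
def denEqTau (μ ν : ℝ) : ℝ :=
  2 * μ * ν * (μ + ν) *
    (192 * μ ^ 8 + 1344 * μ ^ 7 * ν + 4047 * μ ^ 6 * ν ^ 2 + 6770 * μ ^ 5 * ν ^ 3
      + 6799 * μ ^ 4 * ν ^ 4 + 4216 * μ ^ 3 * ν ^ 5 + 1600 * μ ^ 2 * ν ^ 6
      + 344 * μ * ν ^ 7 + 32 * ν ^ 8)

section StrongLaw

variable {Ω : Type*} [MeasurableSpace Ω] {Pr : Measure Ω} {ξ : ℕ → Ω → ℝ} {C : ℝ}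

lemma ae_tendsto_zero_of_summable_integral_sq {Y : ℕ → Ω → ℝ} {b : ℕ → ℝ}
    (hY : ∀ n, MemLp (Y n) 2 Pr) (hb : Summable b) (hYb : ∀ n, ∫ ω, Y n ω ^ 2 ∂Pr ≤ b n) :
    ∀ᵐ ω ∂Pr, Tendsto (fun n => Y n ω) atTop (𝓝 0) := by
  have hmeas : ∀ n, AEMeasurable (fun ω => ENNReal.ofReal (Y n ω ^ 2)) Pr := fun n =>
    (hY n).integrable_sq.aemeasurable.ennreal_ofReal
  have hle : ∀ n, ∫⁻ ω, ENNReal.ofReal (Y n ω ^ 2) ∂Pr ≤ ENNReal.ofReal (b n) := fun n => by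
    rw [← ofReal_integral_eq_lintegral_ofReal (hY n).integrable_sq
      (Eventually.of_forall fun ω => sq_nonneg _)]
    exact ENNReal.ofReal_le_ofReal (hYb n)
  have hfinite : ∫⁻ ω, ∑' n, ENNReal.ofReal (Y n ω ^ 2) ∂Pr ≠ ⊤ := by
    rw [lintegral_tsum hmeas]
    exact ne_top_of_le_ne_top hb.tsum_ofReal_ne_top (ENNReal.tsum_le_tsum hle)
  filter_upwards [ae_lt_top' (AEMeasurable.tsum hmeas) hfinite] with ω hω
  have hsq : Tendsto (fun n => Y n ω ^ 2) atTop (𝓝 0) := by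
    refine ((ENNReal.tendsto_toReal ENNReal.zero_ne_top).comp
      (ENNReal.tendsto_atTop_zero_of_tsum_ne_top hω.ne)).congr fun n => ?_
    exact ENNReal.toReal_ofReal (sq_nonneg _)
  have habs := hsq.sqrt
  simp only [Real.sqrt_sq_eq_abs, Real.sqrt_zero] at habs
  exact (tendsto_zero_iff_abs_tendsto_zero _).2 habs

lemma ae_tendsto_div_sq_of_integral_sq_le {S : ℕ → Ω → ℝ} (hS : ∀ n, MemLp (S n) 2 Pr)
    (hSC : ∀ n ≠ 0, ∫ ω, S n ω ^ 2 ∂Pr ≤ C * (n : ℝ) ^ 2) :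
    ∀ᵐ ω ∂Pr, Tendsto (fun n : ℕ => S n ω / (n : ℝ) ^ 2) atTop (𝓝 0) := by
  have hsummable : Summable fun n : ℕ => C / (n : ℝ) ^ 2 :=
    (Real.summable_nat_pow_inv.2 one_lt_two).mul_left C
  refine ae_tendsto_zero_of_summable_integral_sq (fun n => (hS n).mul_const ((n : ℝ) ^ 2)⁻¹)
    hsummable fun n => ?_
  rcases eq_or_ne n 0 with rfl | hn
  · simp
  · simp only [div_pow, integral_div]
    rw [div_le_div_iff₀ (by positivity) (by positivity)]
    calc (∫ ω, S n ω ^ 2 ∂Pr) * (n : ℝ) ^ 2 ≤ C * (n : ℝ) ^ 2 * (n : ℝ) ^ 2 := by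
          gcongr; exact hSC n hn
      _ = C * ((n : ℝ) ^ 2) ^ 2 := by ring

lemma integral_sq_sum_le_of_orthogonal (hξ : ∀ k, MemLp (ξ k) 2 Pr)
    (hC : ∀ k, ∫ ω, ξ k ω ^ 2 ∂Pr ≤ C) (horth : ∀ j k, j < k → ∫ ω, ξ j ω * ξ k ω ∂Pr = 0)
    (n : ℕ) : ∫ ω, (∑ i ∈ Finset.range n, ξ i ω) ^ 2 ∂Pr ≤ C * n := by
  induction n with
  | zero => simp
  | succ n ih =>
    have hS : MemLp (fun ω => ∑ i ∈ Finset.range n, ξ i ω) 2 Pr :=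
      memLp_finsetSum _ fun i _ => hξ i
    have hcross : ∫ ω, (∑ i ∈ Finset.range n, ξ i ω) * ξ n ω ∂Pr = 0 := by
      simp_rw [Finset.sum_mul]
      rw [integral_finsetSum _ fun i _ => by exact (hξ i).integrable_mul (hξ n)]
      exact Finset.sum_eq_zero fun i hi => horth i n (Finset.mem_range.1 hi)
    have hcross_int : Integrable (fun ω => 2 * ((∑ i ∈ Finset.range n, ξ i ω) * ξ n ω)) Pr :=
      (hS.integrable_mul (hξ n)).const_mul 2
    have hexpand : ∀ ω, (∑ i ∈ Finset.range (n + 1), ξ i ω) ^ 2 =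
        (∑ i ∈ Finset.range n, ξ i ω) ^ 2 + 2 * ((∑ i ∈ Finset.range n, ξ i ω) * ξ n ω)
          + ξ n ω ^ 2 := fun ω => by
      rw [Finset.sum_range_succ]; ring
    simp_rw [hexpand]
    rw [integral_add (by exact hS.integrable_sq.add hcross_int) (hξ n).integrable_sq,
      integral_add hS.integrable_sq hcross_int, integral_const_mul, hcross]
    push_cast
    linarith [hC n]

lemma integral_sq_sum_abs_le (hξ : ∀ k, MemLp (ξ k) 2 Pr) (hC : ∀ k, ∫ ω, ξ k ω ^ 2 ∂Pr ≤ C)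
    (s : Finset ℕ) : ∫ ω, (∑ i ∈ s, |ξ i ω|) ^ 2 ∂Pr ≤ C * (s.card : ℝ) ^ 2 := by
  have hsum : MemLp (fun ω => ∑ i ∈ s, |ξ i ω|) 2 Pr := memLp_finsetSum _ fun i _ => (hξ i).abs
  have hsq : Integrable (fun ω => ∑ i ∈ s, ξ i ω ^ 2) Pr :=
    integrable_finsetSum _ fun i _ => (hξ i).integrable_sq
  calc ∫ ω, (∑ i ∈ s, |ξ i ω|) ^ 2 ∂Pr
      ≤ ∫ ω, s.card * ∑ i ∈ s, ξ i ω ^ 2 ∂Pr :=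
        integral_mono hsum.integrable_sq (hsq.const_mul _) fun ω => by
          simpa only [sq_abs] using sq_sum_le_card_mul_sum_sq (s := s) (f := fun i => |ξ i ω|)
    _ = s.card * ∑ i ∈ s, ∫ ω, ξ i ω ^ 2 ∂Pr := by
        rw [integral_const_mul, integral_finsetSum _ fun i _ => (hξ i).integrable_sq]
    _ ≤ s.card * ∑ _i ∈ s, C := by gcongr with i; exact hC i
    _ = C * (s.card : ℝ) ^ 2 := by rw [Finset.sum_const, nsmul_eq_mul]; ring

lemma tendsto_sum_div_of_tendsto_along_squares {x : ℕ → ℝ}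
    (hsq : Tendsto (fun n : ℕ => (∑ i ∈ Finset.range (n ^ 2), x i) / (n : ℝ) ^ 2) atTop (𝓝 0))
    (hblock : Tendsto (fun n : ℕ => (∑ i ∈ Finset.Ico (n ^ 2) ((n + 1) ^ 2), |x i|) / (n : ℝ) ^ 2)
      atTop (𝓝 0)) :
    Tendsto (fun n : ℕ => (∑ i ∈ Finset.range n, x i) / n) atTop (𝓝 0) := by
  have hsqrt : Tendsto Nat.sqrt atTop atTop :=
    tendsto_atTop_atTop.2 fun n => ⟨n ^ 2, fun m hm => Nat.le_sqrt'.2 hm⟩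
  have hbound := ((hsq.abs.add hblock).comp hsqrt)
  rw [abs_zero, add_zero] at hbound
  refine squeeze_zero_norm' ?_ hbound
  filter_upwards [eventually_gt_atTop 0] with m hm
  have hle : m.sqrt ^ 2 ≤ m := Nat.sqrt_le' m
  have hlt : m < (m.sqrt + 1) ^ 2 := Nat.lt_succ_sqrt' m
  have hpos : (0 : ℝ) < (m.sqrt : ℝ) ^ 2 := by
    have := Nat.sqrt_pos.2 hm
    positivity
  have htail : |∑ i ∈ Finset.Ico (m.sqrt ^ 2) m, x i| ≤
      ∑ i ∈ Finset.Ico (m.sqrt ^ 2) ((m.sqrt + 1) ^ 2), |x i| :=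
    (Finset.abs_sum_le_sum_abs _ _).trans (Finset.sum_le_sum_of_subset_of_nonneg
      (Finset.Ico_subset_Ico_right hlt.le) fun i _ _ => abs_nonneg _)
  rw [Function.comp_apply, Real.norm_eq_abs, abs_div, Nat.abs_cast, abs_div,
    abs_of_pos hpos, ← add_div]
  gcongr
  · rw [← Finset.sum_range_add_sum_Ico _ hle]
    exact (abs_add_le _ _).trans (by gcongr)
  · exact_mod_cast hle

theorem ae_tendsto_sum_div_of_orthogonal (hξ : ∀ k, MemLp (ξ k) 2 Pr)
    (hC : ∀ k, ∫ ω, ξ k ω ^ 2 ∂Pr ≤ C) (horth : ∀ j k, j < k → ∫ ω, ξ j ω * ξ k ω ∂Pr = 0) :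
    ∀ᵐ ω ∂Pr, Tendsto (fun n : ℕ => (∑ i ∈ Finset.range n, ξ i ω) / n) atTop (𝓝 0) := by
  have hsquares := ae_tendsto_div_sq_of_integral_sq_le (C := C)
    (fun n => memLp_finsetSum (Finset.range (n ^ 2)) fun i _ => hξ i) fun n _ => by
      exact_mod_cast integral_sq_sum_le_of_orthogonal hξ hC horth (n ^ 2)
  have hblocks := ae_tendsto_div_sq_of_integral_sq_le (C := C * 9)
    (fun n => memLp_finsetSum (Finset.Ico (n ^ 2) ((n + 1) ^ 2)) fun i _ => (hξ i).abs)
    fun n hn => by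
      have hC0 : 0 ≤ C := (integral_nonneg fun ω => sq_nonneg (ξ 0 ω)).trans (hC 0)
      have hcard : (n + 1) ^ 2 - n ^ 2 ≤ 3 * n := by
        rw [tsub_le_iff_right]
        nlinarith [Nat.one_le_iff_ne_zero.2 hn]
      refine (integral_sq_sum_abs_le hξ hC _).trans ?_
      rw [Nat.card_Ico]
      calc C * (((n + 1) ^ 2 - n ^ 2 : ℕ) : ℝ) ^ 2 ≤ C * ((3 * n : ℕ) : ℝ) ^ 2 := by gcongr
        _ = C * 9 * (n : ℝ) ^ 2 := by push_cast; ring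
  filter_upwards [hsquares, hblocks] with ω h₁ h₂
  exact tendsto_sum_div_of_tendsto_along_squares h₁ h₂

end StrongLaw

section AdditiveFunctional

variable {Ω S E : Type*} {mΩ : MeasurableSpace Ω} [MeasurableSpace S] [MeasurableSpace E]
  {Pr : Measure Ω}

lemma integral_mul_comp_eq_zero_of_indepFun [IsFiniteMeasure Pr] {X : Ω → ℝ} {D : Ω → S}
    {U : Ω → E} (hX : Measurable X) (hD : Measurable D) (hU : Measurable U)
    (hind : IndepFun (fun ω => (X ω, D ω)) U Pr) {Ψ : S → E → ℝ}
    (hΨ : Measurable (Function.uncurry Ψ)) (hΨ0 : ∀ d, ∫ u, Ψ d u ∂Pr.map U = 0)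
    (hint : Integrable (fun ω => X ω * Ψ (D ω) (U ω)) Pr) :
    ∫ ω, X ω * Ψ (D ω) (U ω) ∂Pr = 0 := by
  have hXD : Measurable fun ω => (X ω, D ω) := hX.prodMk hD
  have hXDU : Measurable fun ω => ((X ω, D ω), U ω) := hXD.prodMk hU
  let F : (ℝ × S) × E → ℝ := fun p => p.1.1 * Ψ p.1.2 p.2
  have hF : Measurable F := by
    have hDU : Measurable fun p : (ℝ × S) × E => (p.1.2, p.2) := by fun_prop
    exact (measurable_fst.comp measurable_fst).mul (hΨ.comp hDU)
  have hlaw := (indepFun_iff_map_prod_eq_prod_map_map hXD.aemeasurable hU.aemeasurable).1 hind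
  calc ∫ ω, X ω * Ψ (D ω) (U ω) ∂Pr
      = ∫ p, F p ∂(Pr.map fun ω => (X ω, D ω)).prod (Pr.map U) := by
        rw [← hlaw, integral_map hXDU.aemeasurable hF.aestronglyMeasurable]
    _ = ∫ v, ∫ u, v.1 * Ψ v.2 u ∂Pr.map U ∂Pr.map fun ω => (X ω, D ω) := by
        refine integral_prod _ ?_
        rw [← hlaw]
        exact (integrable_map_measure hF.aestronglyMeasurable hXDU.aemeasurable).2 hint
    _ = 0 := by simp only [integral_const_mul, hΨ0, mul_zero, integral_zero]

/-- The variables `Ψ (D k) (U k)` are orthogonal, since `U k` is independent of the past. -/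
theorem ae_tendsto_sum_div_of_indep_filtration [IsFiniteMeasure Pr] {ℱ : Filtration ℕ mΩ}
    {D : ℕ → Ω → S} {U : ℕ → Ω → E} {ρ : Measure E} (hD : ∀ k, Measurable[ℱ k] (D k))
    (hU : ∀ k, Measurable[ℱ (k + 1)] (U k))
    (hind : ∀ k, Indep (ℱ k) (MeasurableSpace.comap (U k) inferInstance) Pr)
    (hlaw : ∀ k, Pr.map (U k) = ρ) {Ψ : S → E → ℝ} (hΨ : Measurable (Function.uncurry Ψ))
    (hΨ0 : ∀ d, ∫ u, Ψ d u ∂ρ = 0) {G : E → ℝ} (hG : MemLp G 2 ρ)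
    (hΨG : ∀ d u, |Ψ d u| ≤ G u) :
    ∀ᵐ ω ∂Pr, Tendsto (fun n : ℕ => (∑ k ∈ Finset.range n, Ψ (D k ω) (U k ω)) / n) atTop
      (𝓝 0) := by
  have hDm : ∀ k, Measurable (D k) := fun k => (hD k).mono (ℱ.le k) le_rfl
  have hUm : ∀ k, Measurable (U k) := fun k => (hU k).mono (ℱ.le (k + 1)) le_rfl
  have hadapted : ∀ j k, j < k → Measurable[ℱ k] fun ω => Ψ (D j ω) (U j ω) := fun j k hjk =>
    hΨ.comp (((hD j).mono (ℱ.mono hjk.le) le_rfl).prodMk ((hU j).mono (ℱ.mono hjk) le_rfl))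
  have hmeas : ∀ k, Measurable fun ω => Ψ (D k ω) (U k ω) := fun k =>
    (hadapted k (k + 1) k.lt_succ_self).mono (ℱ.le _) le_rfl
  have hGU : ∀ k, MemLp (fun ω => G (U k ω)) 2 Pr := fun k =>
    (hlaw k ▸ hG).comp_of_map (hUm k).aemeasurable
  have hmem : ∀ k, MemLp (fun ω => Ψ (D k ω) (U k ω)) 2 Pr := fun k =>
    (hGU k).mono' (hmeas k).aestronglyMeasurable (Eventually.of_forall fun ω => hΨG _ _)
  refine ae_tendsto_sum_div_of_orthogonal (C := ∫ u, G u ^ 2 ∂ρ) hmem (fun k => ?_)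
    fun j k hjk => ?_
  · calc ∫ ω, Ψ (D k ω) (U k ω) ^ 2 ∂Pr ≤ ∫ ω, G (U k ω) ^ 2 ∂Pr :=
          integral_mono (hmem k).integrable_sq (hGU k).integrable_sq fun ω =>
            sq_le_sq.2 ((hΨG _ _).trans (le_abs_self _))
      _ = ∫ u, G u ^ 2 ∂ρ := by
          rw [← hlaw k, integral_map (hUm k).aemeasurable]
          exact (hlaw k ▸ hG.aestronglyMeasurable).pow 2
  · have hpast : IndepFun (fun ω => (Ψ (D j ω) (U j ω), D k ω)) (U k) Pr :=
      indep_of_indep_of_le_left (hind k) ((hadapted j k hjk).prodMk (hD k)).comap_le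
    exact integral_mul_comp_eq_zero_of_indepFun (hmeas j) (hDm k) (hUm k) hpast hΨ
      (fun d => hlaw k ▸ hΨ0 d) ((hmem j).integrable_mul (hmem k))

end AdditiveFunctional

section MaxPlusSystem

/-- The state of the max-plus system with matrix `!![p.1.1, p.1.2; 0, p.2]` after one step from a
state `(x, y)` with `y - x = d`, both coordinates being taken relative to `max x y`. -/
def relativeStep (d : ℝ) (p : (ℝ × ℝ) × ℝ) : ℝ × ℝ :=
  (max (p.1.1 - max d 0) (p.1.2 - max (-d) 0), max (-max d 0) (p.2 - max (-d) 0))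

/-- The maximum of the state `z` corrected by a function `h` of the difference of its
coordinates. -/
def correctedMax (h : ℝ → ℝ) (z : ℝ × ℝ) : ℝ :=
  max z.1 z.2 + h (z.2 - z.1)

/-- The Poisson equation of the max-plus system with noise law `ρ`: the maximum corrected by `h`
grows by `L` on average in every step, whatever the current difference `d`. -/
def SolvesPoissonEquation (ρ : Measure ((ℝ × ℝ) × ℝ)) (h : ℝ → ℝ) (L : ℝ) : Prop :=
  ∀ d, ∫ p, correctedMax h (relativeStep d p) ∂ρ = h d + L

lemma measurable_uncurry_relativeStep : Measurable (Function.uncurry relativeStep) := by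
  unfold Function.uncurry relativeStep
  fun_prop

lemma measurable_correctedMax {h : ℝ → ℝ} (hh : Measurable h) : Measurable (correctedMax h) := by
  unfold correctedMax
  fun_prop

lemma abs_max_relativeStep_le (d : ℝ) (p : (ℝ × ℝ) × ℝ) :
    |max (relativeStep d p).1 (relativeStep d p).2| ≤ ‖p‖ := by
  obtain ⟨⟨a, b⟩, c⟩ := p
  have ha : |a| ≤ ‖((a, b), c)‖ := (norm_fst_le (a, b)).trans (norm_fst_le ((a, b), c))
  have hb : |b| ≤ ‖((a, b), c)‖ := (norm_snd_le (a, b)).trans (norm_fst_le ((a, b), c))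
  have hc : |c| ≤ ‖((a, b), c)‖ := norm_snd_le ((a, b), c)
  generalize ‖((a, b), c)‖ = r at ha hb hc
  simp only [relativeStep]
  grind

lemma abs_correctedMax_relativeStep_le {h : ℝ → ℝ} {B : ℝ} (hB : ∀ d, |h d| ≤ B) (d : ℝ)
    (p : (ℝ × ℝ) × ℝ) : |correctedMax h (relativeStep d p)| ≤ ‖p‖ + B :=
  (abs_add_le _ _).trans (add_le_add (abs_max_relativeStep_le d p) (hB _))

lemma relativeStep_sub (x y : ℝ) (p : (ℝ × ℝ) × ℝ) :
    relativeStep (y - x) p =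
      (max (x + p.1.1) (y + p.1.2) - max x y, max x (y + p.2) - max x y) := by
  simp only [relativeStep, Prod.mk.injEq]
  grind

lemma correctedMax_sub_sub (h : ℝ → ℝ) (x y m : ℝ) :
    correctedMax h (x - m, y - m) = correctedMax h (x, y) - m := by
  simp only [correctedMax, max_sub_sub_right, sub_sub_sub_cancel_right]
  ring

lemma sum_correctedMax_relativeStep (a b c : ℕ → ℝ) (h : ℝ → ℝ) (L : ℝ) (n : ℕ) :
    let z := maxPlusState fun j => !![a j, b j; 0, c j]
    ∑ k ∈ Finset.range n, (correctedMax h (relativeStep (z k 1 - z k 0) ((a k, b k), c k))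
        - (h (z k 1 - z k 0) + L)) =
      correctedMax h (z n 0, z n 1) - h 0 - n * L := by
  intro z
  have hx : ∀ k, z (k + 1) 0 = max (z k 0 + a k) (z k 1 + b k) := fun k => by
    simp [z, maxPlusState]
  have hy : ∀ k, z (k + 1) 1 = max (z k 0) (z k 1 + c k) := fun k => by simp [z, maxPlusState]
  induction n with
  | zero => simp [z, maxPlusState, correctedMax]
  | succ n ih =>
    rw [Finset.sum_range_succ, ih, relativeStep_sub, correctedMax_sub_sub, ← hx, ← hy]
    simp only [correctedMax]
    push_cast
    ring

lemma tendsto_max_maxPlusState_div (a b c : ℕ → ℝ) {h : ℝ → ℝ} {B : ℝ} (hB : ∀ d, |h d| ≤ B)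
    (L : ℝ) :
    let z := maxPlusState fun j => !![a j, b j; 0, c j]
    Tendsto (fun n : ℕ => (∑ k ∈ Finset.range n,
      (correctedMax h (relativeStep (z k 1 - z k 0) ((a k, b k), c k))
        - (h (z k 1 - z k 0) + L))) / n) atTop (𝓝 0) →
    Tendsto (fun n : ℕ => 1 / (n : ℝ) * max (z n 0) (z n 1)) atTop (𝓝 L) := by
  intro z haverages
  have hboundary : Tendsto (fun n : ℕ => (h 0 - h (z n 1 - z n 0)) * (1 / (n : ℝ))) atTop (𝓝 0) :=
    bdd_le_mul_tendsto_zero' (B + B) (Eventually.of_forall fun n =>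
      (abs_sub _ _).trans (add_le_add (hB _) (hB _))) tendsto_one_div_atTop_nhds_zero_nat
  have hsum := (haverages.add hboundary).add_const L
  rw [zero_add, zero_add] at hsum
  refine hsum.congr' ?_
  filter_upwards [eventually_ne_atTop 0] with n hn
  rw [sum_correctedMax_relativeStep, correctedMax]
  field_simp
  ring

lemma measurable_maxPlusState {Ω : Type*} {mΩ : MeasurableSpace Ω} {ℱ : Filtration ℕ mΩ}
    {a b c : ℕ → Ω → ℝ} (ha : ∀ k, Measurable[ℱ (k + 1)] (a k))
    (hb : ∀ k, Measurable[ℱ (k + 1)] (b k)) (hc : ∀ k, Measurable[ℱ (k + 1)] (c k)) (k : ℕ)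
    (i : Fin 2) :
    Measurable[ℱ k] fun ω => maxPlusState (fun j => !![a j ω, b j ω; 0, c j ω]) k i := by
  induction k generalizing i with
  | zero => exact measurable_const
  | succ k ih =>
    have hx := (ih 0).mono (ℱ.mono k.le_succ) le_rfl
    have hy := (ih 1).mono (ℱ.mono k.le_succ) le_rfl
    fin_cases i
    · simpa [maxPlusState] using (hx.add (ha k)).max (hy.add (hb k))
    · simpa [maxPlusState] using hx.max (hy.add (hc k))

theorem isLyapunovExponent_of_solvesPoissonEquation {Ω : Type*} {mΩ : MeasurableSpace Ω}
    {Pr : Measure Ω} [IsProbabilityMeasure Pr] {ℱ : Filtration ℕ mΩ} {a b c : ℕ → Ω → ℝ}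
    {ρ : Measure ((ℝ × ℝ) × ℝ)} (ha : ∀ k, Measurable[ℱ (k + 1)] (a k))
    (hb : ∀ k, Measurable[ℱ (k + 1)] (b k)) (hc : ∀ k, Measurable[ℱ (k + 1)] (c k))
    (hind : ∀ k, Indep (ℱ k) (MeasurableSpace.comap (fun ω => ((a k ω, b k ω), c k ω))
      inferInstance) Pr)
    (hlaw : ∀ k, Pr.map (fun ω => ((a k ω, b k ω), c k ω)) = ρ) (hρ : MemLp id 2 ρ)
    {h : ℝ → ℝ} {L B : ℝ} (hh : Measurable h) (hB : ∀ d, |h d| ≤ B)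
    (hPoisson : SolvesPoissonEquation ρ h L) :
    IsLyapunovExponent Pr (fun k ω => !![a k ω, b k ω; 0, c k ω]) L := by
  have habc : ∀ k, Measurable[ℱ (k + 1)] fun ω => ((a k ω, b k ω), c k ω) := fun k =>
    ((ha k).prodMk (hb k)).prodMk (hc k)
  have : IsProbabilityMeasure ρ := hlaw 0 ▸
    Measure.isProbabilityMeasure_map ((habc 0).mono (ℱ.le 1) le_rfl).aemeasurable
  have hstep : Measurable (Function.uncurry fun d p => correctedMax h (relativeStep d p)) :=
    (measurable_correctedMax hh).comp measurable_uncurry_relativeStep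
  have hstep_int : ∀ d, Integrable (fun p => correctedMax h (relativeStep d p)) ρ := fun d =>
    ((hρ.integrable one_le_two).norm.add (integrable_const B)).mono'
      (hstep.comp measurable_prodMk_left).aestronglyMeasurable
      (Eventually.of_forall fun p => abs_correctedMax_relativeStep_le hB d p)
  have haverages := ae_tendsto_sum_div_of_indep_filtration
    (fun k => (measurable_maxPlusState ha hb hc k 1).sub (measurable_maxPlusState ha hb hc k 0))
    habc hind hlaw (Ψ := fun d p => correctedMax h (relativeStep d p) - (h d + L))
    (G := fun p => ‖p‖ + B + (B + |L|))
    (hstep.sub ((hh.comp measurable_fst).add_const L))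
    (fun d => by rw [integral_sub (hstep_int d) (integrable_const _), hPoisson d]; simp)
    ((hρ.norm.add (memLp_const B)).add (memLp_const _))
    (fun d p => (abs_sub _ _).trans (add_le_add (abs_correctedMax_relativeStep_le hB d p)
      ((abs_add_le _ _).trans (add_le_add_left (hB d) _))))
  filter_upwards [haverages] with ω hω using tendsto_max_maxPlusState_div _ _ _ hB L hω

end MaxPlusSystem

section IndependentArray

variable {Ω ι E : Type*} {mΩ : MeasurableSpace Ω} [MeasurableSpace E] {Pr : Measure Ω}
  {X : ι × ℕ → Ω → E}

/-- The filtration generated by the rows of a random array: at time `k` it contains the information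
of the rows with index less than `k`. -/
def rowFiltration (hX : ∀ p, Measurable (X p)) : Filtration ℕ mΩ where
  seq k := ⨆ p ∈ {p : ι × ℕ | p.2 < k}, MeasurableSpace.comap (X p) inferInstance
  mono' _ _ hjk := biSup_mono fun _ hp => hp.trans_le hjk
  le' _ := iSup₂_le fun p _ => (hX p).comap_le

lemma measurable_rowFiltration (hX : ∀ p, Measurable (X p)) (i : ι) {j k : ℕ} (hjk : j < k) :
    Measurable[rowFiltration hX k] (X (i, j)) :=
  (comap_measurable (X (i, j))).mono
    (le_iSup₂_of_le (f := fun p (_ : p ∈ {p : ι × ℕ | p.2 < k}) =>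
      MeasurableSpace.comap (X p) inferInstance) (i, j) hjk le_rfl) le_rfl

lemma indep_rowFiltration (hX : ∀ p, Measurable (X p)) (hind : iIndepFun X Pr) (k : ℕ) :
    Indep (rowFiltration hX k) (⨆ i, MeasurableSpace.comap (X (i, k)) inferInstance) Pr := by
  have hdisj : Disjoint {p : ι × ℕ | p.2 < k} {p | p.2 = k} :=
    Set.disjoint_left.2 fun p (hlt : p.2 < k) (heq : p.2 = k) => hlt.ne heq
  refine indep_of_indep_of_le_right
    (indep_iSup_of_disjoint (fun p => (hX p).comap_le) hind.iIndep hdisj) ?_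
  exact iSup_le fun i => le_iSup₂_of_le (f := fun p (_ : p ∈ {p : ι × ℕ | p.2 = k}) =>
    MeasurableSpace.comap (X p) inferInstance) (i, k) rfl le_rfl

lemma map_triple_of_iIndepFun {κ : Type*} {Y : κ → Ω → E} [IsFiniteMeasure Pr]
    (hY : ∀ i, Measurable (Y i)) (hind : iIndepFun Y Pr) {i j l : κ} (hij : i ≠ j)
    (hil : i ≠ l) (hjl : j ≠ l) :
    Pr.map (fun ω => ((Y i ω, Y j ω), Y l ω)) =
      ((Pr.map (Y i)).prod (Pr.map (Y j))).prod (Pr.map (Y l)) := by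
  rw [(indepFun_iff_map_prod_eq_prod_map_map ((hY i).prodMk (hY j)).aemeasurable
      (hY l).aemeasurable).1 (hind.indepFun_prodMk hY i j l hil hjl),
    (indepFun_iff_map_prod_eq_prod_map_map (hY i).aemeasurable (hY j).aemeasurable).1
      (hind.indepFun hij)]

lemma isLyapunovExponent_of_iIndepFun [IsProbabilityMeasure Pr] {X : Fin 3 × ℕ → Ω → ℝ}
    (hX : ∀ p, Measurable (X p)) (hind : iIndepFun X Pr) {ρ₀ ρ₁ ρ₂ : Measure ℝ}
    (h₀ : ∀ k, Pr.map (X (0, k)) = ρ₀) (h₁ : ∀ k, Pr.map (X (1, k)) = ρ₁)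
    (h₂ : ∀ k, Pr.map (X (2, k)) = ρ₂) (hρ : MemLp id 2 ((ρ₀.prod ρ₁).prod ρ₂))
    {h : ℝ → ℝ} {L B : ℝ} (hh : Measurable h) (hB : ∀ d, |h d| ≤ B)
    (hPoisson : SolvesPoissonEquation ((ρ₀.prod ρ₁).prod ρ₂) h L) :
    IsLyapunovExponent Pr (fun k ω => !![X (0, k) ω, X (1, k) ω; 0, X (2, k) ω]) L := by
  have hpast := fun i k => measurable_rowFiltration hX i (Nat.lt_succ_self k)
  refine isLyapunovExponent_of_solvesPoissonEquation (hpast 0) (hpast 1) (hpast 2) (fun k => ?_)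
    (fun k => ?_) hρ hh hB hPoisson
  · have hrow : ∀ i, Measurable[⨆ i, MeasurableSpace.comap (X (i, k)) inferInstance] (X (i, k)) :=
      fun i => (comap_measurable _).mono (le_iSup_of_le i le_rfl) le_rfl
    exact indep_of_indep_of_le_right (indep_rowFiltration hX hind k)
      (((hrow 0).prodMk (hrow 1)).prodMk (hrow 2)).comap_le
  · rw [map_triple_of_iIndepFun hX hind (by simp) (by simp) (by simp), h₀, h₁, h₂]

end IndependentArray

section ExponentialLaws

variable {r s : ℝ}

/-- The survival function of the exponential law with rate `r`: the probability that an
exponential variable exceeds the level `x`. -/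
noncomputable def expTail (r x : ℝ) : ℝ :=
  Real.exp (-(r * max x 0))

lemma measurable_expTail (r : ℝ) : Measurable (expTail r) := by
  unfold expTail
  fun_prop

lemma expTail_nonneg (r x : ℝ) : 0 ≤ expTail r x := (Real.exp_pos _).le

lemma expTail_le_one (hr : 0 < r) (x : ℝ) : expTail r x ≤ 1 :=
  Real.exp_le_one_iff.2 (neg_nonpos.2 (mul_nonneg hr.le (le_max_right x 0)))

lemma expTail_of_nonpos (r : ℝ) {x : ℝ} (hx : x ≤ 0) : expTail r x = 1 := by
  rw [expTail, max_eq_right hx, mul_zero, neg_zero, Real.exp_zero]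

lemma expTail_mul_expTail (r s x : ℝ) : expTail r x * expTail s x = expTail (r + s) x := by
  rw [expTail, expTail, expTail, ← Real.exp_add]
  ring_nf

lemma expTail_add (r : ℝ) {x y : ℝ} (hx : 0 ≤ x) (hy : 0 ≤ y) :
    expTail r (x + y) = expTail r x * expTail r y := by
  rw [expTail, expTail, expTail, max_eq_left hx, max_eq_left hy, max_eq_left (add_nonneg hx hy),
    ← Real.exp_add]
  ring_nf

lemma real_expMeasure_Iic (hr : 0 < r) (x : ℝ) :
    (expMeasure r).real (Set.Iic x) = 1 - expTail r x := by
  have := isProbabilityMeasure_expMeasure hr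
  rw [← cdf_eq_real, cdf_expMeasure_eq hr]
  split_ifs with hx
  · rw [expTail, max_eq_left hx]
  · rw [expTail_of_nonpos r (not_le.1 hx).le, sub_self]

lemma ae_pos_expMeasure (hr : 0 < r) : ∀ᵐ x ∂expMeasure r, 0 < x := by
  have := isProbabilityMeasure_expMeasure hr
  have hcompl : {x : ℝ | ¬ 0 < x} = Set.Iic 0 := by ext x; simp
  rw [ae_iff, hcompl, ← measureReal_eq_zero_iff, real_expMeasure_Iic hr,
    expTail_of_nonpos r le_rfl, sub_self]

lemma expMeasure_eq_withDensity (r : ℝ) :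
    expMeasure r = (volume.restrict (Set.Ioi 0)).withDensity
      fun x => ENNReal.ofReal (r * Real.exp (-(r * x))) := by
  have hpdf : exponentialPDF r = (Set.Ici (0 : ℝ)).indicator
      fun x => ENNReal.ofReal (r * Real.exp (-(r * x))) := by
    ext x
    by_cases hx : 0 ≤ x <;> simp [exponentialPDF_eq, hx]
  change volume.withDensity (exponentialPDF r) = _
  rw [hpdf, withDensity_indicator measurableSet_Ici, restrict_Ioi_eq_restrict_Ici]

lemma integral_expMeasure (hr : 0 < r) (g : ℝ → ℝ) :
    ∫ x, g x ∂expMeasure r = ∫ x in Set.Ioi 0, r * Real.exp (-(r * x)) * g x := by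
  rw [expMeasure_eq_withDensity, integral_withDensity_eq_integral_toReal_smul (by fun_prop)
    (by simp)]
  simp only [smul_eq_mul, ENNReal.toReal_ofReal (mul_nonneg hr.le (Real.exp_pos _).le)]

lemma integrable_expMeasure_iff (hr : 0 < r) (g : ℝ → ℝ) :
    Integrable g (expMeasure r) ↔
      IntegrableOn (fun x => r * Real.exp (-(r * x)) * g x) (Set.Ioi 0) := by
  rw [expMeasure_eq_withDensity, integrable_withDensity_iff_integrable_smul' (by fun_prop)
    (by simp)]
  simp only [smul_eq_mul, ENNReal.toReal_ofReal (mul_nonneg hr.le (Real.exp_pos _).le)]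
  rfl

lemma memLp_id_expMeasure (hr : 0 < r) : MemLp id 2 (expMeasure r) := by
  rw [memLp_two_iff_integrable_sq aestronglyMeasurable_id, integrable_expMeasure_iff hr]
  refine ((integrableOn_rpow_mul_exp_neg_mul_rpow (s := 2) (p := 1) (b := r)
    (by norm_num) one_pos hr).const_mul r).congr (Eventually.of_forall fun x => ?_)
  simp only [Real.rpow_one, Real.rpow_ofNat, id]
  ring_nf

lemma integrable_id_expMeasure (hr : 0 < r) : Integrable id (expMeasure r) :=
  have := isProbabilityMeasure_expMeasure hr
  (memLp_id_expMeasure hr).integrable one_le_two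

lemma integral_id_expMeasure (hr : 0 < r) : ∫ x, x ∂expMeasure r = 1 / r := by
  have hGamma := Real.integral_rpow_mul_exp_neg_mul_Ioi (a := 2) two_pos hr
  norm_num only [Real.rpow_one, Real.rpow_ofNat, Real.Gamma_two] at hGamma
  rw [integral_expMeasure hr]
  simp_rw [mul_assoc, integral_const_mul, mul_comm (Real.exp _), hGamma]
  field_simp

lemma integrable_expTail (hr : 0 < r) (hs : 0 < s) : Integrable (expTail s) (expMeasure r) :=
  have := isProbabilityMeasure_expMeasure hr
  Integrable.of_bound (measurable_expTail s).aestronglyMeasurable 1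
    (Eventually.of_forall fun x => by
      rw [Real.norm_of_nonneg (expTail_nonneg s x)]
      exact expTail_le_one hs x)

lemma integral_expTail (hr : 0 < r) (hs : 0 < s) :
    ∫ x, expTail s x ∂expMeasure r = r / (r + s) := by
  have hcongr : ∀ x ∈ Set.Ioi (0 : ℝ),
      r * Real.exp (-(r * x)) * expTail s x = r * Real.exp (-(r + s) * x) := fun x hx => by
    rw [expTail, max_eq_left (le_of_lt hx), mul_assoc, ← Real.exp_add]
    ring_nf
  rw [integral_expMeasure hr, setIntegral_congr_fun measurableSet_Ioi hcongr, integral_const_mul,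
    integral_exp_mul_Ioi (by linarith), mul_zero, Real.exp_zero]
  field_simp

lemma measure_eq_of_real_Iic_eq {P Q : Measure ℝ} [IsFiniteMeasure P] [IsFiniteMeasure Q]
    (h : ∀ x, P.real (Set.Iic x) = Q.real (Set.Iic x)) : P = Q :=
  Measure.ext_of_Iic _ _ fun x => (measureReal_eq_measureReal_iff).1 (h x)

lemma map_overshoot_expMeasure (hr : 0 < r) (e : ℝ) :
    (expMeasure r).map (fun x => max (x - max e 0) 0) =
      ENNReal.ofReal (1 - expTail r e) • Measure.dirac 0
        + ENNReal.ofReal (expTail r e) • expMeasure r := by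
  have := isProbabilityMeasure_expMeasure hr
  have := (expMeasure r).smul_finite (ENNReal.ofReal_ne_top (r := expTail r e))
  have := (Measure.dirac (0 : ℝ)).smul_finite (ENNReal.ofReal_ne_top (r := 1 - expTail r e))
  refine measure_eq_of_real_Iic_eq fun x => ?_
  rw [map_measureReal_apply (by fun_prop) measurableSet_Iic, measureReal_add_apply,
    measureReal_ennreal_smul_apply, measureReal_ennreal_smul_apply,
    ENNReal.toReal_ofReal (expTail_nonneg r e),
    ENNReal.toReal_ofReal (sub_nonneg.2 (expTail_le_one hr e)), real_expMeasure_Iic hr]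
  rcases lt_or_ge x 0 with hx | hx
  · have hempty : (fun y : ℝ => max (y - max e 0) 0) ⁻¹' Set.Iic x = ∅ := by
      ext y; simp [hx]
    rw [hempty, expTail_of_nonpos r hx.le]
    simp [measureReal_def, hx.not_ge]
  · have hpre : (fun y : ℝ => max (y - max e 0) 0) ⁻¹' Set.Iic x = Set.Iic (x + max e 0) := by
      ext y; simp [hx]
    have htail : expTail r (max e 0) = expTail r e := by simp [expTail]
    rw [hpre, real_expMeasure_Iic hr, expTail_add r hx (le_max_right e 0), htail]
    simp [measureReal_def, hx]
    ring

/-- The law of the maximum of two independent exponential variables with rates `r` and `s`. -/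
noncomputable def expMaxMeasure (r s : ℝ) : Measure ℝ :=
  ((expMeasure r).prod (expMeasure s)).map fun p => max p.1 p.2

lemma isProbabilityMeasure_expMaxMeasure (hr : 0 < r) (hs : 0 < s) :
    IsProbabilityMeasure (expMaxMeasure r s) := by
  have := isProbabilityMeasure_expMeasure hr
  have := isProbabilityMeasure_expMeasure hs
  exact Measure.isProbabilityMeasure_map (by fun_prop)

/-- Inclusion–exclusion, since the minimum of the two variables has rate `r + s`. -/
lemma expMaxMeasure_add_expMeasure (hr : 0 < r) (hs : 0 < s) :
    expMaxMeasure r s + expMeasure (r + s) = expMeasure r + expMeasure s := by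
  have := isProbabilityMeasure_expMeasure hr
  have := isProbabilityMeasure_expMeasure hs
  have := isProbabilityMeasure_expMeasure (add_pos hr hs)
  have := isProbabilityMeasure_expMaxMeasure hr hs
  refine measure_eq_of_real_Iic_eq fun x => ?_
  have hpre : (fun p : ℝ × ℝ => max p.1 p.2) ⁻¹' Set.Iic x = Set.Iic x ×ˢ Set.Iic x := by
    ext p; simp [Prod.le_def]
  have hmax : (expMaxMeasure r s).real (Set.Iic x) = (1 - expTail r x) * (1 - expTail s x) := by
    rw [expMaxMeasure, map_measureReal_apply (by fun_prop) measurableSet_Iic, hpre,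
      measureReal_prod_prod, real_expMeasure_Iic hr, real_expMeasure_Iic hs]
  rw [measureReal_add_apply, measureReal_add_apply, hmax, real_expMeasure_Iic hr,
    real_expMeasure_Iic hs, real_expMeasure_Iic (add_pos hr hs), ← expTail_mul_expTail]
  ring

lemma lintegral_expTail (hr : 0 < r) (hs : 0 < s) :
    ∫⁻ x, ENNReal.ofReal (expTail s x) ∂expMeasure r = ENNReal.ofReal (r / (r + s)) := by
  rw [← ofReal_integral_eq_lintegral_ofReal (integrable_expTail hr hs)
    (Eventually.of_forall (expTail_nonneg s)), integral_expTail hr hs]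

lemma lintegral_one_sub_expTail (hr : 0 < r) (hs : 0 < s) :
    ∫⁻ x, ENNReal.ofReal (1 - expTail s x) ∂expMeasure r = ENNReal.ofReal (s / (r + s)) := by
  have := isProbabilityMeasure_expMeasure hr
  rw [← ofReal_integral_eq_lintegral_ofReal
      (by exact (integrable_const 1).sub (integrable_expTail hr hs))
      (Eventually.of_forall fun x => sub_nonneg.2 (expTail_le_one hs x)),
    integral_sub (integrable_const 1) (integrable_expTail hr hs), integral_expTail hr hs,
    integral_const, probReal_univ, one_smul]
  congr 1
  field_simp
  ring

lemma map_sub_max_zero_expMeasure (hr : 0 < r) (hs : 0 < s) :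
    ((expMeasure r).prod (expMeasure s)).map (fun p => max (p.2 - p.1) 0) =
      ENNReal.ofReal (s / (r + s)) • Measure.dirac 0
        + ENNReal.ofReal (r / (r + s)) • expMeasure s := by
  have := isProbabilityMeasure_expMeasure hs
  have htail := (measurable_expTail s).ennreal_ofReal
  have htail' := ((measurable_expTail s).const_sub 1).ennreal_ofReal
  ext A hA
  have hsection : ∀ᵐ x ∂expMeasure r,
      expMeasure s (Prod.mk x ⁻¹' ((fun p : ℝ × ℝ => max (p.2 - p.1) 0) ⁻¹' A)) =
        ENNReal.ofReal (1 - expTail s x) * Measure.dirac 0 A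
          + ENNReal.ofReal (expTail s x) * expMeasure s A := by
    filter_upwards [ae_pos_expMeasure hr] with x hx
    have hmemoryless := congrArg (· A) (map_overshoot_expMeasure hs x)
    rwa [max_eq_left hx.le, Measure.map_apply (by fun_prop) hA] at hmemoryless
  rw [Measure.map_apply (by fun_prop) hA, Measure.prod_apply (by measurability),
    lintegral_congr_ae hsection, lintegral_add_left (htail'.mul_const _),
    lintegral_mul_const _ htail', lintegral_mul_const _ htail, lintegral_expTail hr hs,
    lintegral_one_sub_expTail hr hs]
  rfl

lemma integrable_max_sub_zero_expMeasure (hr : 0 < r) (hs : 0 < s) {g : ℝ → ℝ}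
    (hgi : Integrable g (expMeasure s)) :
    Integrable (fun p => g (max (p.2 - p.1) 0)) ((expMeasure r).prod (expMeasure s)) := by
  refine Integrable.comp_measurable (f := fun p : ℝ × ℝ => max (p.2 - p.1) 0) ?_ (by fun_prop)
  rw [map_sub_max_zero_expMeasure hr hs]
  exact ((integrable_dirac (by finiteness)).smul_measure ENNReal.ofReal_ne_top).add_measure
    (hgi.smul_measure ENNReal.ofReal_ne_top)

lemma integral_max_sub_zero_expMeasure (hr : 0 < r) (hs : 0 < s) {g : ℝ → ℝ}
    (hg : Measurable g) (hgi : Integrable g (expMeasure s)) :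
    ∫ p, g (max (p.2 - p.1) 0) ∂(expMeasure r).prod (expMeasure s) =
      s / (r + s) * g 0 + r / (r + s) * ∫ x, g x ∂expMeasure s := by
  rw [← integral_map (φ := fun p : ℝ × ℝ => max (p.2 - p.1) 0) (by fun_prop)
      hg.aestronglyMeasurable, map_sub_max_zero_expMeasure hr hs,
    integral_add_measure ((integrable_dirac (by finiteness)).smul_measure ENNReal.ofReal_ne_top)
      (hgi.smul_measure ENNReal.ofReal_ne_top), integral_smul_measure, integral_smul_measure,
    integral_dirac, ENNReal.toReal_ofReal (by positivity), ENNReal.toReal_ofReal (by positivity),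
    smul_eq_mul, smul_eq_mul]

/-- Conditionally on its sign, the difference is exponential on either side of `0`. -/
lemma integral_comp_sub_expMeasure (hr : 0 < r) (hs : 0 < s) {g : ℝ → ℝ} (hg : Measurable g)
    (hgi : Integrable g (expMeasure s)) (hgi' : Integrable (fun x => g (-x)) (expMeasure r)) :
    ∫ p, g (p.2 - p.1) ∂(expMeasure r).prod (expMeasure s) =
      r / (r + s) * ∫ x, g x ∂expMeasure s + s / (r + s) * ∫ x, g (-x) ∂expMeasure r := by
  have := isProbabilityMeasure_expMeasure hr
  have := isProbabilityMeasure_expMeasure hs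
  have hpos := integrable_max_sub_zero_expMeasure hr hs hgi
  have hneg : Integrable (fun p => g (-max (p.1 - p.2) 0))
      ((expMeasure r).prod (expMeasure s)) := (integrable_max_sub_zero_expMeasure hs hr hgi').swap
  have hneg_eq : ∫ p, g (-max (p.1 - p.2) 0) ∂(expMeasure r).prod (expMeasure s) =
      r / (s + r) * g (-0) + s / (s + r) * ∫ x, g (-x) ∂expMeasure r := by
    rw [← integral_max_sub_zero_expMeasure hs hr (g := fun x => g (-x)) (hg.comp measurable_neg)
      hgi', ← integral_prod_swap]
    rfl
  have hsplit : ∀ x y : ℝ, g (y - x) = g (max (y - x) 0) + g (-max (x - y) 0) - g 0 := by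
    intro x y
    rcases le_total x y with h | h
    · rw [max_eq_left (sub_nonneg.2 h), max_eq_right (sub_nonpos.2 h), neg_zero,
        add_sub_cancel_right]
    · rw [max_eq_right (sub_nonpos.2 h), max_eq_left (sub_nonneg.2 h), neg_sub,
        add_sub_cancel_left]
  simp_rw [hsplit]
  rw [integral_sub (by exact hpos.add hneg) (integrable_const _), integral_add hpos hneg,
    integral_max_sub_zero_expMeasure hr hs hg hgi, hneg_eq, neg_zero, integral_const,
    probReal_univ, one_smul]
  field_simp
  ring

lemma integral_max_expMeasure (hr : 0 < r) (hs : 0 < s) :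
    ∫ p, max p.1 p.2 ∂(expMeasure r).prod (expMeasure s) = 1 / r + r / (r + s) * (1 / s) := by
  have := isProbabilityMeasure_expMeasure hr
  have := isProbabilityMeasure_expMeasure hs
  have hmax : ∀ p : ℝ × ℝ, max p.1 p.2 = p.1 + id (max (p.2 - p.1) 0) := fun p => by
    rw [id, ← max_add_add_left, add_sub_cancel, add_zero, max_comm]
  simp_rw [hmax]
  rw [integral_add (by exact (integrable_id_expMeasure hr).comp_fst _)
    (integrable_max_sub_zero_expMeasure hr hs (integrable_id_expMeasure hs)),
    integral_max_sub_zero_expMeasure hr hs measurable_id (integrable_id_expMeasure hs),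
    integral_fun_fst (fun x => x)]
  simp only [probReal_univ, one_smul, id, mul_zero, zero_add, integral_id_expMeasure hr,
    integral_id_expMeasure hs]

end ExponentialLaws

section StepLaws

variable {r s μ ν τ : ℝ}

lemma expMaxMeasure_comm (hr : 0 < r) (hs : 0 < s) : expMaxMeasure r s = expMaxMeasure s r := by
  have := isProbabilityMeasure_expMeasure hr
  have := isProbabilityMeasure_expMeasure hs
  rw [expMaxMeasure, expMaxMeasure, ← Measure.prod_swap,
    Measure.map_map (by fun_prop) (by fun_prop)]
  congr 1
  ext p
  exact max_comm _ _

lemma map_max_overshoot (hr : 0 < r) (hs : 0 < s) (e : ℝ) :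
    ((expMeasure r).prod (expMeasure s)).map (fun p => max p.1 (p.2 - max e 0)) =
      ENNReal.ofReal (1 - expTail s e) • expMeasure r
        + ENNReal.ofReal (expTail s e) • expMaxMeasure r s := by
  have := isProbabilityMeasure_expMeasure hr
  have := isProbabilityMeasure_expMeasure hs
  have := (expMeasure s).smul_finite (ENNReal.ofReal_ne_top (r := expTail s e))
  have := (Measure.dirac (0 : ℝ)).smul_finite (ENNReal.ofReal_ne_top (r := 1 - expTail s e))
  have hovershoot : (fun p : ℝ × ℝ => max p.1 (p.2 - max e 0))
      =ᵐ[(expMeasure r).prod (expMeasure s)]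
      (fun p => max p.1 p.2) ∘ Prod.map id fun x => max (x - max e 0) 0 := by
    filter_upwards [Measure.quasiMeasurePreserving_fst.ae (ae_pos_expMeasure hr)] with p hp
    simp only [Function.comp_apply, Prod.map_fst, Prod.map_snd, id]
    rw [max_comm (p.2 - _), ← max_assoc, max_eq_left hp.le]
  have hzero : (expMeasure r).map (fun x => max x 0) = expMeasure r := by
    rw [Measure.map_congr (g := id) ?_, Measure.map_id]
    filter_upwards [ae_pos_expMeasure hr] with x hx using max_eq_left hx.le
  rw [Measure.map_congr hovershoot, ← Measure.map_map (by fun_prop) (by fun_prop),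
    ← Measure.map_prod_map _ _ measurable_id (by fun_prop), Measure.map_id,
    map_overshoot_expMeasure hs, Measure.prod_add, Measure.prod_smul_right,
    Measure.prod_smul_right, Measure.map_add _ _ (by fun_prop), Measure.map_smul,
    Measure.map_smul, Measure.prod_dirac, Measure.map_map (by fun_prop) (by fun_prop)]
  simp only [Function.comp_def, hzero, expMaxMeasure]

/-- The five laws whose mixtures are the laws of `relativeStep d`, for all differences `d`, when the
noise is exponential with rates `μ`, `ν` and `τ`. -/
noncomputable def stepLaw (μ ν τ : ℝ) : Fin 5 → Measure (ℝ × ℝ) :=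
  ![(expMeasure μ).prod (Measure.dirac 0), (expMaxMeasure μ ν).prod (Measure.dirac 0),
    (expMeasure μ).prod (expMeasure τ), (expMaxMeasure μ ν).prod (expMeasure τ),
    (expMeasure ν).prod (expMeasure τ)]

/-- The weights of the five laws `stepLaw μ ν τ` in the law of `relativeStep d`. As
`expTail r x = 1` for `x ≤ 0`, the first three vanish for `d ≥ 0` and the last one vanishes for
`d ≤ 0`. -/
noncomputable def stepWeight (μ ν τ d : ℝ) : Fin 5 → ℝ :=
  ![(1 - expTail τ (-d)) * (1 - expTail ν (-d)), (1 - expTail τ (-d)) * expTail ν (-d),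
    expTail τ (-d) * (1 - expTail ν (-d)), expTail τ (-d) * expTail ν (-d) * expTail μ d,
    1 - expTail μ d]

lemma map_relativeStep_of_nonpos (hμ : 0 < μ) (hν : 0 < ν) (hτ : 0 < τ) {d : ℝ} (hd : d ≤ 0) :
    (((expMeasure μ).prod (expMeasure ν)).prod (expMeasure τ)).map (relativeStep d) =
      (ENNReal.ofReal (1 - expTail ν (-d)) • expMeasure μ
        + ENNReal.ofReal (expTail ν (-d)) • expMaxMeasure μ ν).prod
      (ENNReal.ofReal (1 - expTail τ (-d)) • Measure.dirac 0
        + ENNReal.ofReal (expTail τ (-d)) • expMeasure τ) := by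
  have := isProbabilityMeasure_expMeasure hμ
  have := isProbabilityMeasure_expMeasure hν
  have := isProbabilityMeasure_expMeasure hτ
  have hstep : relativeStep d = Prod.map (fun q : ℝ × ℝ => max q.1 (q.2 - max (-d) 0))
      fun c => max (c - max (-d) 0) 0 := by
    ext p
    · simp [relativeStep, hd]
    · simp [relativeStep, hd, max_comm]
  rw [hstep, ← Measure.map_prod_map _ _ (by fun_prop) (by fun_prop), map_max_overshoot hμ hν,
    map_overshoot_expMeasure hτ]

lemma map_relativeStep_of_nonneg (hμ : 0 < μ) (hν : 0 < ν) (hτ : 0 < τ) {d : ℝ} (hd : 0 ≤ d) :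
    (((expMeasure μ).prod (expMeasure ν)).prod (expMeasure τ)).map (relativeStep d) =
      (ENNReal.ofReal (1 - expTail μ d) • expMeasure ν
        + ENNReal.ofReal (expTail μ d) • expMaxMeasure μ ν).prod (expMeasure τ) := by
  have := isProbabilityMeasure_expMeasure hμ
  have := isProbabilityMeasure_expMeasure hν
  have := isProbabilityMeasure_expMeasure hτ
  have hstep : relativeStep d =ᵐ[((expMeasure μ).prod (expMeasure ν)).prod (expMeasure τ)]
      Prod.map ((fun q : ℝ × ℝ => max q.1 (q.2 - max d 0)) ∘ Prod.swap) id := by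
    filter_upwards [Measure.quasiMeasurePreserving_snd.ae (ae_pos_expMeasure hτ)] with p hp
    ext
    · simp [relativeStep, hd, max_comm]
    · simp [relativeStep, hd, (neg_nonpos.2 hd).trans hp.le]
  rw [Measure.map_congr hstep, ← Measure.map_prod_map _ _ (by fun_prop) measurable_id,
    Measure.map_id, ← Measure.map_map (by fun_prop) (by fun_prop), Measure.prod_swap,
    map_max_overshoot hν hμ, expMaxMeasure_comm hν hμ]

lemma map_relativeStep_expMeasure (hμ : 0 < μ) (hν : 0 < ν) (hτ : 0 < τ) (d : ℝ) :
    (((expMeasure μ).prod (expMeasure ν)).prod (expMeasure τ)).map (relativeStep d) =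
      ∑ i, ENNReal.ofReal (stepWeight μ ν τ d i) • stepLaw μ ν τ i := by
  have := isProbabilityMeasure_expMeasure hμ
  have := isProbabilityMeasure_expMeasure hν
  have := isProbabilityMeasure_expMeasure hτ
  have := isProbabilityMeasure_expMaxMeasure hμ hν
  rcases le_total d 0 with hd | hd
  · rw [map_relativeStep_of_nonpos hμ hν hτ hd]
    have hτ' := expTail_le_one hτ (-d)
    simp only [stepWeight, stepLaw, Fin.sum_univ_five, Matrix.cons_val, expTail_of_nonpos μ hd,
      Measure.prod_add, Measure.add_prod, Measure.prod_smul_left, Measure.prod_smul_right, smul_add,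
      smul_smul, sub_self, mul_one, ENNReal.ofReal_zero, zero_smul, add_zero,
      ENNReal.ofReal_mul (sub_nonneg.2 hτ'), ENNReal.ofReal_mul (expTail_nonneg τ (-d))]
    abel
  · rw [map_relativeStep_of_nonneg hμ hν hτ hd]
    simp only [stepWeight, stepLaw, Fin.sum_univ_five, Matrix.cons_val,
      expTail_of_nonpos ν (neg_nonpos.2 hd), expTail_of_nonpos τ (neg_nonpos.2 hd), sub_self,
      mul_one, one_mul, mul_zero, ENNReal.ofReal_zero, zero_smul, zero_add, Measure.add_prod,
      Measure.prod_smul_left]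
    exact add_comm _ _

lemma stepWeight_nonneg (hμ : 0 < μ) (hν : 0 < ν) (hτ : 0 < τ) (d : ℝ) (i : Fin 5) :
    0 ≤ stepWeight μ ν τ d i := by
  have hμ' := sub_nonneg.2 (expTail_le_one hμ d)
  have hν' := sub_nonneg.2 (expTail_le_one hν (-d))
  have hτ' := sub_nonneg.2 (expTail_le_one hτ (-d))
  have hμ'' := expTail_nonneg μ d
  have hν'' := expTail_nonneg ν (-d)
  have hτ'' := expTail_nonneg τ (-d)
  fin_cases i <;> simp only [stepWeight, Fin.reduceFinMk, Matrix.cons_val] <;> positivity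

lemma sum_stepWeight (μ ν τ d : ℝ) : ∑ i, stepWeight μ ν τ d i = 1 := by
  simp only [stepWeight, Fin.sum_univ_five, Matrix.cons_val]
  rcases le_total d 0 with hd | hd
  · rw [expTail_of_nonpos μ hd]
    ring
  · rw [expTail_of_nonpos ν (neg_nonpos.2 hd), expTail_of_nonpos τ (neg_nonpos.2 hd)]
    ring

lemma measurable_stepWeight (μ ν τ : ℝ) (i : Fin 5) :
    Measurable fun d => stepWeight μ ν τ d i := by
  have := measurable_expTail μ
  have := measurable_expTail ν
  have := measurable_expTail τ
  fin_cases i <;> simp only [stepWeight, Fin.reduceFinMk, Matrix.cons_val] <;> fun_prop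

end StepLaws

section Corrector

variable {r s μ ν τ : ℝ}

lemma solvesPoissonEquation_of_mixture {ι : Type*} [Fintype ι] {ρ : Measure ((ℝ × ℝ) × ℝ)}
    {P : ι → Measure (ℝ × ℝ)} {w : ℝ → ι → ℝ} {f : ι → ℝ} {L : ℝ}
    (hw : ∀ d i, 0 ≤ w d i) (hsum : ∀ d, ∑ i, w d i = 1)
    (hmeas : Measurable fun d => ∑ i, w d i * f i)
    (hmix : ∀ d, ρ.map (relativeStep d) = ∑ i, ENNReal.ofReal (w d i) • P i)
    (hint : ∀ i, Integrable (correctedMax fun d => ∑ i, w d i * f i) (P i))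
    (hf : ∀ i, ∫ z, correctedMax (fun d => ∑ i, w d i * f i) z ∂P i = f i + L) :
    SolvesPoissonEquation ρ (fun d => ∑ i, w d i * f i) L := by
  intro d
  have hstep : Measurable (relativeStep d) :=
    measurable_uncurry_relativeStep.comp measurable_prodMk_left
  rw [← integral_map hstep.aemeasurable (measurable_correctedMax hmeas).aestronglyMeasurable,
    hmix d, integral_finsetSum_measure fun i _ =>
      (hint i).smul_measure ENNReal.ofReal_ne_top]
  simp_rw [integral_smul_measure, hf, ENNReal.toReal_ofReal (hw d _), smul_eq_mul, mul_add]
  rw [Finset.sum_add_distrib, ← Finset.sum_mul, hsum, one_mul]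

/-- The candidate solution of the Poisson equation with exponential noise. As the law of every step
is a mixture of the laws `stepLaw μ ν τ`, it takes one number `f i` for each of these laws. -/
noncomputable def corrector (μ ν τ : ℝ) (f : Fin 5 → ℝ) (d : ℝ) : ℝ :=
  ∑ i, stepWeight μ ν τ d i * f i

lemma measurable_corrector (μ ν τ : ℝ) (f : Fin 5 → ℝ) : Measurable (corrector μ ν τ f) :=
  Finset.measurable_fun_sum _ fun i _ => (measurable_stepWeight μ ν τ i).mul_const _

lemma abs_corrector_le (hμ : 0 < μ) (hν : 0 < ν) (hτ : 0 < τ) (f : Fin 5 → ℝ) (d : ℝ) :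
    |corrector μ ν τ f d| ≤ ∑ i, |f i| := by
  have hnonneg := stepWeight_nonneg hμ hν hτ d
  refine (Finset.abs_sum_le_sum_abs _ _).trans (Finset.sum_le_sum fun i _ => ?_)
  rw [abs_mul, abs_of_nonneg (hnonneg i)]
  refine mul_le_of_le_one_left (abs_nonneg _) ?_
  rw [← sum_stepWeight μ ν τ d]
  exact Finset.single_le_sum (fun j _ => hnonneg j) (Finset.mem_univ i)

lemma integrable_comp_of_abs_le {α : Type*} [MeasurableSpace α] {P : Measure α} [IsFiniteMeasure P]
    {h : ℝ → ℝ} {B : ℝ} (hh : Measurable h) (hB : ∀ d, |h d| ≤ B) {g : α → ℝ}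
    (hg : Measurable g) : Integrable (fun x => h (g x)) P :=
  Integrable.of_bound (hh.comp hg).aestronglyMeasurable B (Eventually.of_forall fun x => hB (g x))

lemma integrable_correctedMax_prod {P Q : Measure ℝ} [IsFiniteMeasure P] [IsFiniteMeasure Q]
    (hP : Integrable id P) (hQ : Integrable id Q) {h : ℝ → ℝ} {B : ℝ} (hh : Measurable h)
    (hB : ∀ d, |h d| ≤ B) : Integrable (correctedMax h) (P.prod Q) :=
  ((hP.comp_fst Q).sup (hQ.comp_snd P)).add
    (integrable_comp_of_abs_le hh hB (measurable_snd.sub measurable_fst))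

lemma integral_correctedMax_prod_dirac (hr : 0 < r) {h : ℝ → ℝ} {B : ℝ} (hh : Measurable h)
    (hB : ∀ d, |h d| ≤ B) :
    ∫ z, correctedMax h z ∂(expMeasure r).prod (Measure.dirac 0) =
      1 / r + ∫ x, h (-x) ∂expMeasure r := by
  have := isProbabilityMeasure_expMeasure hr
  have hcongr : ∀ᵐ x ∂expMeasure r, correctedMax h (x, 0) = x + h (-x) := by
    filter_upwards [ae_pos_expMeasure hr] with x hx
    rw [correctedMax, max_eq_left hx.le, zero_sub]
  rw [Measure.prod_dirac, integral_map (by fun_prop)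
      (measurable_correctedMax hh).aestronglyMeasurable, integral_congr_ae hcongr,
    integral_add (by exact integrable_id_expMeasure hr)
      (integrable_comp_of_abs_le hh hB measurable_neg),
    integral_id_expMeasure hr]

lemma integral_correctedMax_prod_expMeasure (hr : 0 < r) (hs : 0 < s) {h : ℝ → ℝ} {B : ℝ}
    (hh : Measurable h) (hB : ∀ d, |h d| ≤ B) :
    ∫ z, correctedMax h z ∂(expMeasure r).prod (expMeasure s) =
      1 / r + r / (r + s) * (1 / s) + (r / (r + s) * ∫ x, h x ∂expMeasure s
        + s / (r + s) * ∫ x, h (-x) ∂expMeasure r) := by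
  have := isProbabilityMeasure_expMeasure hr
  have := isProbabilityMeasure_expMeasure hs
  have hmax : Integrable (fun z : ℝ × ℝ => max z.1 z.2) ((expMeasure r).prod (expMeasure s)) :=
    ((integrable_id_expMeasure hr).comp_fst _).sup ((integrable_id_expMeasure hs).comp_snd _)
  simp only [correctedMax]
  rw [integral_add hmax
      (by exact integrable_comp_of_abs_le hh hB (measurable_snd.sub measurable_fst)),
    integral_max_expMeasure hr hs,
    integral_comp_sub_expMeasure hr hs hh (integrable_comp_of_abs_le hh hB measurable_id)
      (integrable_comp_of_abs_le hh hB measurable_neg)]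

lemma integrable_id_expMaxMeasure (hr : 0 < r) (hs : 0 < s) :
    Integrable id (expMaxMeasure r s) := by
  refine Integrable.left_of_add_measure (ν := expMeasure (r + s)) ?_
  rw [expMaxMeasure_add_expMeasure hr hs]
  exact (integrable_id_expMeasure hr).add_measure (integrable_id_expMeasure hs)

lemma integral_correctedMax_expMaxMeasure_prod (hr : 0 < r) (hs : 0 < s) {Q : Measure ℝ}
    [IsFiniteMeasure Q] (hQ : Integrable id Q) {h : ℝ → ℝ} {B : ℝ} (hh : Measurable h)
    (hB : ∀ d, |h d| ≤ B) :
    ∫ z, correctedMax h z ∂(expMaxMeasure r s).prod Q =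
      ∫ z, correctedMax h z ∂(expMeasure r).prod Q + ∫ z, correctedMax h z ∂(expMeasure s).prod Q
        - ∫ z, correctedMax h z ∂(expMeasure (r + s)).prod Q := by
  have hrs := add_pos hr hs
  have := isProbabilityMeasure_expMeasure hr
  have := isProbabilityMeasure_expMeasure hs
  have := isProbabilityMeasure_expMeasure hrs
  have := isProbabilityMeasure_expMaxMeasure hr hs
  have hint : ∀ {P : Measure ℝ} [IsFiniteMeasure P], Integrable id P →
      Integrable (correctedMax h) (P.prod Q) := fun hP => integrable_correctedMax_prod hP hQ hh hB
  rw [eq_sub_iff_add_eq, ← integral_add_measure (hint (integrable_id_expMaxMeasure hr hs))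
      (hint (integrable_id_expMeasure hrs)),
    ← integral_add_measure (hint (integrable_id_expMeasure hr))
      (hint (integrable_id_expMeasure hs)),
    ← Measure.add_prod, ← Measure.add_prod, expMaxMeasure_add_expMeasure hr hs]

lemma integrable_correctedMax_stepLaw (hμ : 0 < μ) (hν : 0 < ν) (hτ : 0 < τ) {h : ℝ → ℝ} {B : ℝ}
    (hh : Measurable h) (hB : ∀ d, |h d| ≤ B) (i : Fin 5) :
    Integrable (correctedMax h) (stepLaw μ ν τ i) := by
  have := isProbabilityMeasure_expMeasure hμ
  have := isProbabilityMeasure_expMeasure hν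
  have := isProbabilityMeasure_expMeasure hτ
  have := isProbabilityMeasure_expMaxMeasure hμ hν
  have hid₀ : Integrable id (Measure.dirac (0 : ℝ)) := integrable_dirac (by finiteness)
  fin_cases i
  exacts [integrable_correctedMax_prod (integrable_id_expMeasure hμ) hid₀ hh hB,
    integrable_correctedMax_prod (integrable_id_expMaxMeasure hμ hν) hid₀ hh hB,
    integrable_correctedMax_prod (integrable_id_expMeasure hμ) (integrable_id_expMeasure hτ) hh hB,
    integrable_correctedMax_prod (integrable_id_expMaxMeasure hμ hν)
      (integrable_id_expMeasure hτ) hh hB,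
    integrable_correctedMax_prod (integrable_id_expMeasure hν) (integrable_id_expMeasure hτ) hh hB]

lemma integral_corrector_expMeasure (hμ : 0 < μ) (ν τ : ℝ) (hr : 0 < r)
    (f : Fin 5 → ℝ) :
    ∫ x, corrector μ ν τ f x ∂expMeasure r = f 4 + r / (r + μ) * (f 3 - f 4) := by
  have := isProbabilityMeasure_expMeasure hr
  have hcongr : ∀ᵐ x ∂expMeasure r, corrector μ ν τ f x = f 4 + expTail μ x * (f 3 - f 4) := by
    filter_upwards [ae_pos_expMeasure hr] with x hx
    simp only [corrector, stepWeight, Fin.sum_univ_five, Matrix.cons_val,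
      expTail_of_nonpos _ (neg_nonpos.2 hx.le)]
    ring
  rw [integral_congr_ae hcongr, integral_add (integrable_const _)
    ((integrable_expTail hr hμ).mul_const _), integral_mul_const, integral_expTail hr hμ,
    integral_const, probReal_univ, one_smul]

/-- The mean of the corrector at `-x`, for `x` exponential with rate `r`. -/
noncomputable def correctorNegMean (ν τ : ℝ) (f : Fin 5 → ℝ) (r : ℝ) : ℝ :=
  f 0 + r / (r + τ) * (f 2 - f 0) + r / (r + ν) * (f 1 - f 0)
    + r / (r + (τ + ν)) * (f 0 - f 1 - f 2 + f 3)

lemma integral_corrector_neg_expMeasure (μ : ℝ) (hν : 0 < ν) (hτ : 0 < τ) (hr : 0 < r)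
    (f : Fin 5 → ℝ) :
    ∫ x, corrector μ ν τ f (-x) ∂expMeasure r = correctorNegMean ν τ f r := by
  have := isProbabilityMeasure_expMeasure hr
  have hcongr : ∀ᵐ x ∂expMeasure r, corrector μ ν τ f (-x) =
      f 0 + expTail τ x * (f 2 - f 0) + expTail ν x * (f 1 - f 0)
        + expTail (τ + ν) x * (f 0 - f 1 - f 2 + f 3) := by
    filter_upwards [ae_pos_expMeasure hr] with x hx
    simp only [corrector, stepWeight, Fin.sum_univ_five, Matrix.cons_val, neg_neg,
      expTail_of_nonpos _ (neg_nonpos.2 hx.le), ← expTail_mul_expTail]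
    ring
  have htail : ∀ {s : ℝ}, 0 < s → ∀ c : ℝ, Integrable (fun x => expTail s x * c) (expMeasure r) :=
    fun hs c => (integrable_expTail hr hs).mul_const c
  have hτν := add_pos hτ hν
  rw [integral_congr_ae hcongr, integral_add (by
      exact ((integrable_const _).add (htail hτ _)).add (htail hν _)) (htail hτν _),
    integral_add (by exact (integrable_const _).add (htail hτ _)) (htail hν _),
    integral_add (integrable_const _) (htail hτ _)]
  simp only [integral_mul_const, integral_expTail hr hτ, integral_expTail hr hν,
    integral_expTail hr hτν, integral_const, probReal_univ, one_smul, correctorNegMean]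

/-- The mean of the corrected maximum under the product of the exponential law with rate `r` and
the point mass at `0`. -/
noncomputable def correctedMeanZero (ν τ : ℝ) (f : Fin 5 → ℝ) (r : ℝ) : ℝ :=
  1 / r + correctorNegMean ν τ f r

/-- The mean of the corrected maximum under the product of the exponential laws with rates `r` and
`τ`. -/
noncomputable def correctedMeanExp (μ ν τ : ℝ) (f : Fin 5 → ℝ) (r : ℝ) : ℝ :=
  1 / r + r / (r + τ) * (1 / τ) + (r / (r + τ) * (f 4 + τ / (τ + μ) * (f 3 - f 4))
    + τ / (r + τ) * correctorNegMean ν τ f r)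

/-- The means of the corrected maximum under the five laws `stepLaw μ ν τ`. -/
noncomputable def correctedMean (μ ν τ : ℝ) (f : Fin 5 → ℝ) : Fin 5 → ℝ :=
  ![correctedMeanZero ν τ f μ,
    correctedMeanZero ν τ f μ + correctedMeanZero ν τ f ν - correctedMeanZero ν τ f (μ + ν),
    correctedMeanExp μ ν τ f μ,
    correctedMeanExp μ ν τ f μ + correctedMeanExp μ ν τ f ν - correctedMeanExp μ ν τ f (μ + ν),
    correctedMeanExp μ ν τ f ν]

lemma integral_correctedMax_stepLaw (hμ : 0 < μ) (hν : 0 < ν) (hτ : 0 < τ) (f : Fin 5 → ℝ)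
    (i : Fin 5) :
    ∫ z, correctedMax (corrector μ ν τ f) z ∂stepLaw μ ν τ i = correctedMean μ ν τ f i := by
  have hh := measurable_corrector μ ν τ f
  have hB := abs_corrector_le hμ hν hτ f
  have := isProbabilityMeasure_expMeasure hτ
  have hzero : ∀ {r : ℝ}, 0 < r →
      ∫ z, correctedMax (corrector μ ν τ f) z ∂(expMeasure r).prod (Measure.dirac 0) =
        correctedMeanZero ν τ f r := fun hr => by
    rw [integral_correctedMax_prod_dirac hr hh hB, integral_corrector_neg_expMeasure μ hν hτ hr,
      correctedMeanZero]
  have hexp : ∀ {r : ℝ}, 0 < r →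
      ∫ z, correctedMax (corrector μ ν τ f) z ∂(expMeasure r).prod (expMeasure τ) =
        correctedMeanExp μ ν τ f r := fun hr => by
    rw [integral_correctedMax_prod_expMeasure hr hτ hh hB, integral_corrector_expMeasure hμ ν τ hτ,
      integral_corrector_neg_expMeasure μ hν hτ hr, correctedMeanExp]
  have hμν := add_pos hμ hν
  fin_cases i
  · exact hzero hμ
  · exact (integral_correctedMax_expMaxMeasure_prod hμ hν (integrable_dirac (by finiteness)) hh
      hB).trans (by rw [hzero hμ, hzero hν, hzero hμν]; rfl)
  · exact hexp hμ
  · exact (integral_correctedMax_expMaxMeasure_prod hμ hν (integrable_id_expMeasure hτ) hh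
      hB).trans (by rw [hexp hμ, hexp hν, hexp hμν]; rfl)
  · exact hexp hν

/-- The `5 × 5` linear system for `f` to which the Poisson equation for `corrector μ ν τ f`
reduces. -/
def IsPoissonSolution (μ ν τ : ℝ) (f : Fin 5 → ℝ) (L : ℝ) : Prop :=
  ∀ i, correctedMean μ ν τ f i = f i + L

lemma isPoissonSolution_iff {f : Fin 5 → ℝ} {L : ℝ} :
    IsPoissonSolution μ ν τ f L ↔
      correctedMeanZero ν τ f μ = f 0 + L ∧
      correctedMeanZero ν τ f ν - correctedMeanZero ν τ f (μ + ν) = f 1 - f 0 ∧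
      correctedMeanExp μ ν τ f μ = f 2 + L ∧
      correctedMeanExp μ ν τ f ν = f 4 + L ∧
      correctedMeanExp μ ν τ f (μ + ν) = f 2 + f 4 - f 3 + L := by
  rw [IsPoissonSolution, Fin.forall_fin_succ, Fin.forall_fin_succ, Fin.forall_fin_succ,
    Fin.forall_fin_succ, Fin.forall_fin_one]
  simp only [correctedMean, Fin.reduceSucc, Matrix.cons_val]
  constructor
  · rintro ⟨h₀, h₁, h₂, h₃, h₄⟩
    exact ⟨h₀, by linear_combination h₁ - h₀, h₂, h₄, by linear_combination h₂ + h₄ - h₃⟩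
  · rintro ⟨h₀, h₁, h₂, h₄, h₃⟩
    exact ⟨h₀, by linear_combination h₁ + h₀, h₂, by linear_combination h₂ + h₄ - h₃, h₄⟩

lemma IsPoissonSolution.solvesPoissonEquation (hμ : 0 < μ) (hν : 0 < ν) (hτ : 0 < τ)
    {f : Fin 5 → ℝ} {L : ℝ} (hf : IsPoissonSolution μ ν τ f L) :
    SolvesPoissonEquation (((expMeasure μ).prod (expMeasure ν)).prod (expMeasure τ))
      (corrector μ ν τ f) L :=
  solvesPoissonEquation_of_mixture (stepWeight_nonneg hμ hν hτ) (sum_stepWeight μ ν τ)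
    (measurable_corrector μ ν τ f) (map_relativeStep_expMeasure hμ hν hτ)
    (integrable_correctedMax_stepLaw hμ hν hτ (measurable_corrector μ ν τ f)
      (abs_corrector_le hμ hν hτ f))
    fun i => (integral_correctedMax_stepLaw hμ hν hτ f i).trans (hf i)

lemma memLp_id_prod {E F : Type*} [NormedAddCommGroup E] [NormedAddCommGroup F]
    [MeasurableSpace E] [MeasurableSpace F] {P : Measure E} {Q : Measure F} [IsFiniteMeasure P]
    [IsFiniteMeasure Q] {p : ENNReal} (hP : MemLp id p P) (hQ : MemLp id p Q) :
    MemLp id p (P.prod Q) :=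
  MemLp.of_fst_snd ⟨hP.comp_fst Q, hQ.comp_snd P⟩

lemma isLyapunovExponent_of_isPoissonSolution {Ω : Type*} {mΩ : MeasurableSpace Ω} {Pr : Measure Ω}
    [IsProbabilityMeasure Pr] (hμ : 0 < μ) (hν : 0 < ν) (hτ : 0 < τ) {X : Fin 3 × ℕ → Ω → ℝ}
    (hX : ∀ p, Measurable (X p)) (hind : iIndepFun X Pr)
    (h₀ : ∀ k, Pr.map (X (0, k)) = expMeasure μ) (h₁ : ∀ k, Pr.map (X (1, k)) = expMeasure ν)
    (h₂ : ∀ k, Pr.map (X (2, k)) = expMeasure τ) {f : Fin 5 → ℝ} {L : ℝ}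
    (hf : IsPoissonSolution μ ν τ f L) :
    IsLyapunovExponent Pr (fun k ω => !![X (0, k) ω, X (1, k) ω; 0, X (2, k) ω]) L := by
  have := isProbabilityMeasure_expMeasure hμ
  have := isProbabilityMeasure_expMeasure hν
  have := isProbabilityMeasure_expMeasure hτ
  exact isLyapunovExponent_of_iIndepFun hX hind h₀ h₁ h₂
    (memLp_id_prod (memLp_id_prod (memLp_id_expMeasure hμ) (memLp_id_expMeasure hν))
      (memLp_id_expMeasure hτ))
    (measurable_corrector μ ν τ f) (abs_corrector_le hμ hν hτ f)
    (hf.solvesPoissonEquation hμ hν hτ)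

end Corrector

lemma exists_isPoissonSolution_nu_eq {μ τ : ℝ} (hμ : 0 < μ) (hτ : 0 < τ) :
    ∃ f, IsPoissonSolution μ μ τ f (numEqNu μ τ / denEqNu μ τ) := by
  set Q : ℝ := 144 * μ ^ 7 + 524 * μ ^ 6 * τ + 968 * μ ^ 5 * τ ^ 2 + 1200 * μ ^ 4 * τ ^ 3
      + 910 * μ ^ 3 * τ ^ 4 + 387 * μ ^ 2 * τ ^ 5 + 84 * μ * τ ^ 6 + 7 * τ ^ 7 with hQ
  have hQ0 : Q ≠ 0 := by positivity
  have hL : numEqNu μ τ / denEqNu μ τ = numEqNu μ τ / (2 * μ * τ * Q) := rfl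
  -- The solution of the linear system normalized by `f 3 = 0`.
  refine ⟨![-(144 * μ ^ 8 + 524 * μ ^ 7 * τ + 824 * μ ^ 6 * τ ^ 2 + 856 * μ ^ 5 * τ ^ 3
      + 723 * μ ^ 4 * τ ^ 4 + 455 * μ ^ 3 * τ ^ 5 + 178 * μ ^ 2 * τ ^ 6 + 37 * μ * τ ^ 7
      + 3 * τ ^ 8) / (μ * τ * Q),
    -(144 * μ ^ 7 + 524 * μ ^ 6 * τ + 716 * μ ^ 5 * τ ^ 2 + 535 * μ ^ 4 * τ ^ 3
      + 249 * μ ^ 3 * τ ^ 4 + 74 * μ ^ 2 * τ ^ 5 + 13 * μ * τ ^ 6 + τ ^ 7) / (τ * Q),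
    -(τ ^ 2 * (252 * μ ^ 5 + 665 * μ ^ 4 * τ + 661 * μ ^ 3 * τ ^ 2 + 313 * μ ^ 2 * τ ^ 3
      + 71 * μ * τ ^ 4 + 6 * τ ^ 5)) / (2 * μ * Q), 0,
    -(τ ^ 2 * (252 * μ ^ 5 + 665 * μ ^ 4 * τ + 661 * μ ^ 3 * τ ^ 2 + 313 * μ ^ 2 * τ ^ 3
      + 71 * μ * τ ^ 4 + 6 * τ ^ 5)) / (2 * μ * Q)], ?_⟩
  rw [isPoissonSolution_iff, hL]
  simp only [correctedMeanZero, correctedMeanExp, correctorNegMean, numEqNu, Matrix.cons_val]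
  refine ⟨?_, ?_, ?_, ?_, ?_⟩ <;> (field_simp; rw [hQ]; ring)

lemma exists_isPoissonSolution_tau_eq {μ ν : ℝ} (hμ : 0 < μ) (hν : 0 < ν) :
    ∃ f, IsPoissonSolution μ ν μ f (numEqTau μ ν / denEqTau μ ν) := by
  set Q : ℝ := 192 * μ ^ 8 + 1344 * μ ^ 7 * ν + 4047 * μ ^ 6 * ν ^ 2 + 6770 * μ ^ 5 * ν ^ 3
      + 6799 * μ ^ 4 * ν ^ 4 + 4216 * μ ^ 3 * ν ^ 5 + 1600 * μ ^ 2 * ν ^ 6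
      + 344 * μ * ν ^ 7 + 32 * ν ^ 8 with hQ
  have hQ0 : Q ≠ 0 := by positivity
  have hL : numEqTau μ ν / denEqTau μ ν = numEqTau μ ν / (2 * μ * ν * (μ + ν) * Q) := rfl
  -- The solution of the linear system normalized by `f 3 = 0`.
  refine ⟨![-(128 * μ ^ 10 + 1024 * μ ^ 9 * ν + 3618 * μ ^ 8 * ν ^ 2 + 7615 * μ ^ 7 * ν ^ 3
      + 10665 * μ ^ 6 * ν ^ 4 + 10327 * μ ^ 5 * ν ^ 5 + 7009 * μ ^ 4 * ν ^ 6
      + 3302 * μ ^ 3 * ν ^ 7 + 1032 * μ ^ 2 * ν ^ 8 + 192 * μ * ν ^ 9 + 16 * ν ^ 10)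
        / (μ * ν * (μ + ν) * Q),
    -(64 * μ ^ 9 + 656 * μ ^ 8 * ν + 2704 * μ ^ 7 * ν ^ 2 + 5860 * μ ^ 6 * ν ^ 3
      + 7468 * μ ^ 5 * ν ^ 4 + 5992 * μ ^ 4 * ν ^ 5 + 3104 * μ ^ 3 * ν ^ 6
      + 1016 * μ ^ 2 * ν ^ 7 + 192 * μ * ν ^ 8 + 16 * ν ^ 9) / (μ * (μ + ν) * Q),
    -(μ * (128 * μ ^ 8 + 848 * μ ^ 7 * ν + 2292 * μ ^ 6 * ν ^ 2 + 3354 * μ ^ 5 * ν ^ 3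
      + 2958 * μ ^ 4 * ν ^ 4 + 1602 * μ ^ 3 * ν ^ 5 + 522 * μ ^ 2 * ν ^ 6
      + 96 * μ * ν ^ 7 + 8 * ν ^ 8)) / (ν * (μ + ν) * Q), 0,
    -(32 * μ ^ 7 * ν + 363 * μ ^ 6 * ν ^ 2 + 1240 * μ ^ 5 * ν ^ 3
      + 1903 * μ ^ 4 * ν ^ 4 + 1518 * μ ^ 3 * ν ^ 5 + 672 * μ ^ 2 * ν ^ 6
      + 160 * μ * ν ^ 7 + 16 * ν ^ 8) / (μ * Q)], ?_⟩
  rw [isPoissonSolution_iff, hL]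
  simp only [correctedMeanZero, correctedMeanExp, correctorNegMean, numEqTau, Matrix.cons_val]
  refine ⟨?_, ?_, ?_, ?_, ?_⟩ <;> (field_simp; rw [hQ]; ring)

theorem mainTheorem7 {Ω : Type*} [MeasurableSpace Ω] (Pr : Measure Ω) [IsProbabilityMeasure Pr]
    (μ ν τ : ℝ) (hμ : 0 < μ) (hν : 0 < ν) (hτ : 0 < τ)
    (α β δ : ℕ → Ω → ℝ)
    (hαm : ∀ k, Measurable (α k)) (hβm : ∀ k, Measurable (β k)) (hδm : ∀ k, Measurable (δ k))
    (hα : ∀ k, Pr.map (α k) = expMeasure μ)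
    (hβ : ∀ k, Pr.map (β k) = expMeasure ν)
    (hδ : ∀ k, Pr.map (δ k) = expMeasure τ)
    (hindep : iIndepFun (fun p : Fin 3 × ℕ => ![α, β, δ] p.1 p.2) Pr) :
    (ν = μ →
      IsLyapunovExponent Pr (fun k ω => !![α k ω, β k ω; 0, δ k ω])
        (numEqNu μ τ / denEqNu μ τ)) ∧
    (τ = μ →
      IsLyapunovExponent Pr (fun k ω => !![α k ω, β k ω; 0, δ k ω])
        (numEqTau μ ν / denEqTau μ ν)) := by
  have hX : ∀ p : Fin 3 × ℕ, Measurable (![α, β, δ] p.1 p.2) := by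
    rintro ⟨i, k⟩
    fin_cases i
    exacts [hαm k, hβm k, hδm k]
  constructor
  · rintro rfl
    obtain ⟨f, hf⟩ := exists_isPoissonSolution_nu_eq hν hτ
    exact isLyapunovExponent_of_isPoissonSolution hν hν hτ hX hindep hα hβ hδ hf
  · rintro rfl
    obtain ⟨f, hf⟩ := exists_isPoissonSolution_tau_eq hτ hν
    exact isLyapunovExponent_of_isPoissonSolution hτ hν hτ hX hindep hα hβ hδ hf
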